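/- Let $\mu$ be a non-atomic positive Radon measure on $\mathbb R$ with $\mu((-\infty,a))=\mu([a,\infty))=\infty$ for all $a\in\mathbb R$. Fix $x_0\in\mathbb R$ and, for each $r>0$, a partition of $\mathbb R$ into intervals $I_i^r=[a_i^r,a_{i+1}^r)$, $i\in\mathbb Z$, with $a_0^r=x_0$ and $\mu(I_i^r)=r$. Norms $\|\cdot\|_q$ are those of $L^q(\mathbb R,\mu)$. For $q,p,\alpha\in[1,\infty]$ let $X^{q,p,\alpha}$ be the space of complex $\mu$-measurable functions $f$ on $\mathbb R$ (modulo equality $\mu$-a.e.) with $$\sup_{r>0} r^{\frac1\alpha-\frac1q}\,\Big\|\big(\|f\chi_{I_i^r}\|_q\big)_{i\in\mathbb Z}\Big\|_{\ell^p(\mathbb Z)}<\infty .$$ Let $1\le q\le\beta<\infty$ and define $p,\eta\in[1,\infty]$ by $\frac1p=\frac1q-\frac1\beta$ and $\frac1\eta=1-\frac1\beta$. Put $$\mathfrak m^\mu_{q,\beta}f(x)=\sup_{I\ni x}\mu(I)^{\frac1\beta-\frac1q}\|f\chi_I\|_q ,$$ the supremum being over all intervals $I$ of finite measure containing $x$.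 Let $k:\mathbb R\to[0,\infty]$ be even, non-increasing on $[0,\infty)$, lower semicontinuous, and such that $$\sup_{x}\|k(x-\cdot)\|^*_{\eta,\infty}<\infty,\qquad \sup_{y}\|k(\cdot-y)\|^*_{\eta,\infty}<\infty,$$ where $\|g\|^*_{\eta,\infty}=\sup_{\lambda>0}\lambda\,\mu(\{|g|>\lambda\})^{1/\eta}$ (the essential supremum of $|g|$ if $\eta=\infty$). Put $Kf(x)=\int_{\mathbb R}k(x-y)f(y)\,d\mu(y)$, with the convention $|Kf(x)|=\infty$ at the points where this integral does not converge absolutely (so that for $f\ge0$ the function $Kf$ is the integral with values in $[0,\infty]$). Assume that 1. there is a real constant $C_0$ such that $$\limsup_{r\to\infty}\,\sup_{t\in\mathbb R}\frac{\mu([t,t+r])}{\mu([0,r])}\le C_0,\qquad \limsup_{r\to\infty}\,\sup_{t\in\mathbb R}\frac{\mu([t-r,t])}{\mu([-r,0])}\le C_0;$$ 2. $\rho$ is a positive Borel measure on $\mathbb R$ satisfying condition $\mathcal A^\mu_\infty$: for every $\varepsilon>0$ there is $\delta>0$ such that for every interval $I$ and every Borel set $E\subset I$, $\mu(E)\le\delta\mu(I)$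 implies $\rho(E)\le\varepsilon\rho(I)$. Then for every $\kappa>0$ there is a constant $C>0$ such that, for every $\alpha$ with $q\le\alpha\le p$ and every $f\in X^{q,p,\alpha}$, $$\sup_{\lambda>0}\lambda^\kappa\rho(\{x:|Kf(x)|>\lambda\})\le C\,\sup_{\lambda>0}\lambda^\kappa\rho(\{x:\mathfrak m^\mu_{q,\beta}f(x)>\lambda\}).$$ -/

import Mathlib

open MeasureTheory Set Filter
open scoped ENNReal NNReal

namespace PotentialControl

/-- `a r i = a_i^r`: for every `r > 0` the intervals `[a_i^r, a_{i+1}^r)`, `i ∈ ℤ`, form a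
partition of `ℝ` into intervals of `μ`-measure `r`, with `a_0^r = x₀`. -/
structure IsPartitionSystem (μ : Measure ℝ) (x₀ : ℝ) (a : ℝ → ℤ → ℝ) : Prop where
  base : ∀ r : ℝ, 0 < r → a r 0 = x₀
  strictMono : ∀ r : ℝ, 0 < r → StrictMono (a r)
  cover : ∀ r : ℝ, 0 < r → ⋃ i : ℤ, Ico (a r i) (a r (i + 1)) = univ
  measure_eq : ∀ r : ℝ, 0 < r → ∀ i : ℤ, μ (Ico (a r i) (a r (i + 1))) = ENNReal.ofReal r

open Classical in
/-- The amalgam norm `_r‖f‖_{q,p}`: the `ℓ^p(ℤ)` norm of `i ↦ ‖f χ_{[a_i^r, a_{i+1}^r)}‖_q`. -/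
noncomputable def amalgamNorm (μ : Measure ℝ) (a : ℝ → ℤ → ℝ) (r : ℝ) (q p : ℝ≥0∞)
    (f : ℝ → ℂ) : ℝ≥0∞ :=
  if p = ∞ then ⨆ i : ℤ, eLpNorm ((Ico (a r i) (a r (i + 1))).indicator f) q μ
  else (∑' i : ℤ, eLpNorm ((Ico (a r i) (a r (i + 1))).indicator f) q μ ^ p.toReal) ^
    (1 / p.toReal)

/-- `‖f‖_{q,p,α} = sup_{r > 0} r^{1/α - 1/q} _r‖f‖_{q,p}`. -/
noncomputable def fofanaNorm (μ : Measure ℝ) (a : ℝ → ℤ → ℝ) (q p α : ℝ≥0∞)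
    (f : ℝ → ℂ) : ℝ≥0∞ :=
  ⨆ (r : ℝ) (_ : 0 < r),
    ENNReal.ofReal r ^ ((α⁻¹).toReal - (q⁻¹).toReal) * amalgamNorm μ a r q p f

/-- `f` belongs to the space `X^{q,p,α}`. -/
def MemX (μ : Measure ℝ) (a : ℝ → ℤ → ℝ) (q p α : ℝ≥0∞) (f : ℝ → ℂ) : Prop :=
  AEStronglyMeasurable f μ ∧ fofanaNorm μ a q p α f < ∞

open Classical in
/-- The weak Lebesgue quasi-norm `‖g‖*_{η,∞} = sup_{t > 0} t μ({g > t})^{1/η}` of a nonnegative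
function; for `η = ∞` it is the essential supremum. -/
noncomputable def weakNorm (μ : Measure ℝ) (η : ℝ≥0∞) (g : ℝ → ℝ≥0∞) : ℝ≥0∞ :=
  if η = ∞ then essSup g μ
  else ⨆ t : ℝ≥0, (t : ℝ≥0∞) * μ {x | (t : ℝ≥0∞) < g x} ^ (1 / η.toReal)

/-- The maximal function `m_{q,β}^μ f(x) = sup_{x ∈ I} μ(I)^{1/β - 1/q} ‖f χ_I‖_q`, the supremum
being over all intervals `I` of finite measure that contain `x`. -/
noncomputable def maximalFn (μ : Measure ℝ) (q β : ℝ≥0∞) (f : ℝ → ℂ) (x : ℝ) : ℝ≥0∞ :=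
  ⨆ (I : Set ℝ) (_ : I.OrdConnected) (_ : x ∈ I) (_ : μ I < ∞),
    μ I ^ ((β⁻¹).toReal - (q⁻¹).toReal) * eLpNorm (I.indicator f) q μ

/-- The operator `Kf(x) = ∫ k(x - y) f(y) dμ(y)`, at the points where the integral converges
absolutely. -/
noncomputable def potential (μ : Measure ℝ) (k : ℝ → ℝ≥0∞) (f : ℝ → ℂ) (x : ℝ) : ℂ :=
  ∫ y, ((k (x - y)).toReal : ℂ) * f y ∂μ

open Classical in
/-- The function `|Kf|` with values in `[0, ∞]`. It is `|Kf(x)|` where the integral defining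
`Kf(x)` converges absolutely and `∞` elsewhere. Thus for `f ≥ 0` it is the integral
`∫ k(x - y) f(y) dμ(y) ∈ [0, ∞]` at every point. -/
noncomputable def absPotential (μ : Measure ℝ) (k : ℝ → ℝ≥0∞) (f : ℝ → ℂ) (x : ℝ) : ℝ≥0∞ :=
  if ∫⁻ y, k (x - y) * ‖f y‖ₑ ∂μ < ∞ then ‖potential μ k f x‖ₑ else ∞

/-- The condition `A_∞^μ` on a Borel measure `ρ`. -/
def AInfty (μ ρ : Measure ℝ) : Prop :=
  ∀ ε : ℝ≥0, 0 < ε → ∃ δ : ℝ≥0, 0 < δ ∧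
    ∀ I : Set ℝ, I.OrdConnected → ∀ E : Set ℝ, MeasurableSet E → E ⊆ I →
      μ E ≤ (δ : ℝ≥0∞) * μ I → ρ E ≤ (ε : ℝ≥0∞) * ρ I

/-- `sup_{t > 0} t^κ ρ({g > t})`. -/
noncomputable def weakSup (ρ : Measure ℝ) (κ : ℝ) (g : ℝ → ℝ≥0∞) : ℝ≥0∞ :=
  ⨆ (t : ℝ≥0) (_ : 0 < t), (t : ℝ≥0∞) ^ κ * ρ {x | (t : ℝ≥0∞) < g x}

end PotentialControl

namespace PotentialControl

/-! The argument is a good-λ inequality in which monotonicity of `k` on the line replaces any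
doubling. With θ = 1/η, Hölder reduces everything to nonnegative `g` with ∫_I g ≤ m(x) μ(I)^θ for x
∈ I (`dominatesAverages_maximalFn`). The set {Kg > t} is open, and bounded when `g` is integrable
with bounded support. On a component (c,d), mass left of c contributes at most Kg(c) ≤ t and mass
right of d at most Kg(d) ≤ t. So Kg > 3t forces the local part to be at least t. By Chebyshev,
Tonelli and the weak type of `k`, this happens on a small μ-fraction of (c,d) if m ≤ γt somewhere in
it (`measure_component_le`). Condition A_∞ transfers this to ρ, and summing gives `good_lambda`. The
term with ε is absorbed in `weakSup_le_of_good_lambda`, after an a priori finiteness supplied by the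
far-field bound Kg ≤ C m. Monotone convergence removes the truncation. The endpoint θ = 0 is
separate: unless `g` or ρ vanishes, the right side is infinite. -/

/-- The potential `x ↦ ∫ k(x - y) g(y) dμ(y)` of a nonnegative function `g`. -/
noncomputable def lpotential (μ : Measure ℝ) (k g : ℝ → ℝ≥0∞) (x : ℝ) : ℝ≥0∞ :=
  ∫⁻ y, k (x - y) * g y ∂μ

/-- The kernel `k` is uniformly of weak type: `t μ({k(· - z) > t})^θ ≤ C` for all `z` and `t`. -/
def WeakKernel (μ : Measure ℝ) (k : ℝ → ℝ≥0∞) (θ : ℝ) (C : ℝ≥0∞) : Prop :=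
  ∀ z : ℝ, ∀ t : ℝ≥0, (t : ℝ≥0∞) * μ {x | (t : ℝ≥0∞) < k (x - z)} ^ θ ≤ C

/-- The function `m` dominates the fractional averages of `g` over bounded intervals. -/
def DominatesAverages (μ : Measure ℝ) (θ : ℝ) (g m : ℝ → ℝ≥0∞) : Prop :=
  ∀ I : Set ℝ, I.OrdConnected → Bornology.IsBounded I → ∀ x ∈ I,
    ∫⁻ y in I, g y ∂μ ≤ m x * μ I ^ θ

/-! ### Kernel estimates -/

theorem kernel_le_of_abs_le {k : ℝ → ℝ≥0∞} (hk_even : ∀ x, k (-x) = k x)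
    (hk_anti : AntitoneOn k (Ici 0)) {x y : ℝ} (h : |x| ≤ |y|) : k y ≤ k x := by
  have habs : ∀ z, k |z| = k z := fun z => by
    rcases abs_choice z with hz | hz <;> simp [hz, hk_even]
  rw [← habs x, ← habs y]
  exact hk_anti (abs_nonneg x) (abs_nonneg y) h

/-- For t < k(s), monotonicity puts the whole ball inside {k(· - z) > t}; then t increases to k(s).
This turns weak type into pointwise decay, uniformly in the centre. -/
theorem kernel_mul_measure_closedBall_le {μ : Measure ℝ} {k : ℝ → ℝ≥0∞} {θ : ℝ} {C : ℝ≥0∞}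
    (hk_even : ∀ x, k (-x) = k x) (hk_anti : AntitoneOn k (Ici 0)) (hθ : 0 ≤ θ)
    (hK : WeakKernel μ k θ C) (z : ℝ) {s : ℝ} (hs : 0 ≤ s) :
    k s * μ (Metric.closedBall z s) ^ θ ≤ C := by
  refine ENNReal.mul_le_of_forall_lt fun t ht b hb => ?_
  lift t to ℝ≥0 using ht.ne_top
  refine le_trans ?_ (hK z t)
  gcongr
  refine hb.le.trans ?_
  gcongr
  intro x hx
  refine lt_of_lt_of_le ht (kernel_le_of_abs_le hk_even hk_anti ?_)
  rw [abs_of_nonneg hs]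
  simpa [Real.dist_eq] using hx

/-- A function of weak type `1/θ` with `θ < 1` is integrable on sets of finite measure. -/
theorem exists_lintegral_le_of_weak {θ : ℝ} (h0 : 0 < θ) (h1 : θ < 1) {C : ℝ≥0} (hC : 0 < C) :
    ∃ D : ℝ≥0, ∀ ν : Measure ℝ, ν univ ≠ ∞ → ∀ u : ℝ → ℝ≥0∞, Measurable u →
      (∀ t : ℝ≥0, (t : ℝ≥0∞) * ν {x | (t : ℝ≥0∞) < u x} ^ θ ≤ C) →
      ∫⁻ x, u x ∂ν ≤ D * ν univ ^ (1 - θ) := by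
  have hr : (2 : ℝ≥0∞) ^ (1 - 1 / θ) < 1 := by
    apply ENNReal.rpow_lt_one_of_one_lt_of_neg (by norm_num)
    have : 1 < 1 / θ := by rw [lt_div_iff₀ h0]; linarith
    linarith
  set r : ℝ≥0∞ := (2 : ℝ≥0∞) ^ (1 - 1 / θ) with hrdef
  have hsum : (∑' j : ℕ, r ^ j) ≠ ∞ := by
    rw [ENNReal.tsum_geometric]
    simpa [tsub_eq_zero_iff_le] using hr
  refine ⟨C * (1 + 2 * (∑' j : ℕ, r ^ j).toNNReal), fun ν hν u hu hw => ?_⟩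
  push_cast
  rw [ENNReal.coe_toNNReal hsum]
  rcases eq_or_ne (ν univ) 0 with h | h
  · rw [Measure.measure_univ_eq_zero.1 h]; simp
  set M : ℝ≥0 := (ν univ).toNNReal with hM
  have hMe : ν univ = M := (ENNReal.coe_toNNReal hν).symm
  have hM0 : M ≠ 0 := fun h' => h (by rw [hMe, h']; rfl)
  -- At this level the weak bound equals the total mass M. The dyadic levels 2^j s above it
  -- contribute a geometric series of ratio 2^(1 - 1/θ), which is below 1 since θ < 1.
  set s : ℝ≥0 := C * M ^ (-θ) with hs
  have hs0 : s ≠ 0 := mul_ne_zero hC.ne' (by simp [NNReal.rpow_eq_zero_iff, hM0])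
  have hpt : ∀ x, u x ≤ s + ∑' j : ℕ, {x | ((2 ^ j * s : ℝ≥0) : ℝ≥0∞) < u x}.indicator
      (fun _ => ((2 * (2 ^ j * s) : ℝ≥0) : ℝ≥0∞)) x := by
    intro x
    by_cases hx : u x ≤ s
    · exact hx.trans le_self_add
    push Not at hx
    by_cases hb : ∃ n : ℕ, u x ≤ ((2 ^ n * s : ℝ≥0) : ℝ≥0∞)
    · classical
      set n := Nat.find hb with hn
      have hn1 := Nat.find_spec hb
      rw [← hn] at hn1
      obtain ⟨j, hj⟩ : ∃ j, n = j + 1 := by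
        refine Nat.exists_eq_succ_of_ne_zero fun h0 => ?_
        rw [h0] at hn1
        simp at hn1
        exact absurd hx (not_lt.2 hn1)
      have hj1 := Nat.find_min hb (m := j) (by omega)
      push Not at hj1
      refine le_trans ?_ (le_trans (ENNReal.le_tsum j) le_add_self)
      rw [indicator_of_mem (by exact hj1)]
      rw [hj] at hn1
      refine hn1.trans_eq ?_
      congr 1; ring
    · push Not at hb
      have : ∀ j : ℕ, {x | ((2 ^ j * s : ℝ≥0) : ℝ≥0∞) < u x}.indicator
          (fun _ => ((2 * (2 ^ j * s) : ℝ≥0) : ℝ≥0∞)) x ≥ s := by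
        intro j
        rw [indicator_of_mem (by exact hb j), ge_iff_le, ENNReal.coe_le_coe]
        calc s = 1 * (1 * s) := by ring
          _ ≤ 2 * (2 ^ j * s) := by
            refine mul_le_mul (by norm_num) ?_ (by positivity) (by norm_num)
            exact mul_le_mul_left (one_le_pow₀ (by norm_num)) s
      have : ∑' j : ℕ, {x | ((2 ^ j * s : ℝ≥0) : ℝ≥0∞) < u x}.indicator
          (fun _ => ((2 * (2 ^ j * s) : ℝ≥0) : ℝ≥0∞)) x = ∞ := by
        refine top_unique ?_
        calc ∞ = ∑' _ : ℕ, (s : ℝ≥0∞) := by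
              rw [ENNReal.tsum_const_eq_top_of_ne_zero (by simpa using hs0)]
          _ ≤ _ := ENNReal.tsum_le_tsum this
      rw [this]; simp
  have hmeas : ∀ j : ℕ, ν {x | ((2 ^ j * s : ℝ≥0) : ℝ≥0∞) < u x} ≤
      (((2 : ℝ≥0) ^ (-(j : ℝ) / θ) * M : ℝ≥0) : ℝ≥0∞) := by
    intro j
    have h2 := hw (2 ^ j * s)
    have hp : (2 ^ j * s : ℝ≥0) ≠ 0 := mul_ne_zero (by positivity) hs0
    rw [mul_comm, ← ENNReal.le_div_iff_mul_le (by simp [hs0]) (by simp)] at h2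
    have h3 : (C : ℝ≥0∞) / ((2 ^ j * s : ℝ≥0) : ℝ≥0∞) =
        (((2 : ℝ≥0) ^ (-(j : ℝ) / θ) * M : ℝ≥0) : ℝ≥0∞) ^ θ := by
      rw [← ENNReal.coe_div hp, ← ENNReal.coe_rpow_of_nonneg _ h0.le]
      congr 1
      rw [NNReal.mul_rpow, ← NNReal.rpow_mul, div_mul_cancel₀ _ h0.ne', hs, NNReal.rpow_neg,
        NNReal.rpow_neg, NNReal.rpow_natCast]
      have : M ^ θ ≠ 0 := by simp [NNReal.rpow_eq_zero_iff, hM0]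
      field_simp
    rw [h3] at h2
    exact (ENNReal.rpow_le_rpow_iff h0).1 h2
  have hms : ∀ j : ℕ, MeasurableSet {x | ((2 ^ j * s : ℝ≥0) : ℝ≥0∞) < u x} := fun j =>
    measurableSet_lt measurable_const hu
  have hsM : (s : ℝ≥0∞) * M = C * ν univ ^ (1 - θ) := by
    rw [hMe, ← ENNReal.coe_rpow_of_ne_zero hM0]
    norm_cast
    rw [hs, mul_assoc, sub_eq_neg_add, NNReal.rpow_add hM0, NNReal.rpow_one]
  calc ∫⁻ x, u x ∂ν ≤ ∫⁻ x, (s + ∑' j : ℕ, {x | ((2 ^ j * s : ℝ≥0) : ℝ≥0∞) < u x}.indicator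
      (fun _ => ((2 * (2 ^ j * s) : ℝ≥0) : ℝ≥0∞)) x) ∂ν := lintegral_mono hpt
    _ = s * M + ∑' j : ℕ, ((2 * (2 ^ j * s) : ℝ≥0) : ℝ≥0∞) *
        ν {x | ((2 ^ j * s : ℝ≥0) : ℝ≥0∞) < u x} := by
      rw [lintegral_add_left measurable_const, lintegral_const, hMe,
        lintegral_tsum fun j => (measurable_const.indicator (hms j)).aemeasurable]
      simp_rw [lintegral_indicator_const (hms _)]
    _ ≤ s * M + ∑' j : ℕ, (s * M : ℝ≥0∞) * (2 * r ^ j) := by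
      refine add_le_add_right (ENNReal.tsum_le_tsum fun j => ?_) _
      refine (mul_le_mul_right (hmeas j) _).trans_eq ?_
      have : r ^ j = (((2 : ℝ≥0) ^ j * (2 : ℝ≥0) ^ (-(j : ℝ) / θ) : ℝ≥0) : ℝ≥0∞) := by
        rw [hrdef, ← ENNReal.rpow_natCast, ← ENNReal.rpow_mul]
        rw [← NNReal.rpow_natCast, ← NNReal.rpow_add (by norm_num),
          ENNReal.coe_rpow_of_ne_zero (by norm_num)]
        congr 1
        ring
      rw [this]
      norm_cast
      ring
    _ = C * (1 + 2 * ∑' j : ℕ, r ^ j) * ν univ ^ (1 - θ) := by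
      rw [ENNReal.tsum_mul_left, ENNReal.tsum_mul_left, hsM]
      ring

theorem exists_setLIntegral_kernel_le {μ : Measure ℝ} {k : ℝ → ℝ≥0∞} {θ : ℝ} {C : ℝ≥0}
    (h0 : 0 < θ) (h1 : θ < 1) (hk : Measurable k) (hK : WeakKernel μ k θ C) :
    ∃ D : ℝ≥0, ∀ J : Set ℝ, μ J ≠ ∞ → ∀ y : ℝ,
      ∫⁻ x in J, k (x - y) ∂μ ≤ D * μ J ^ (1 - θ) := by
  obtain ⟨D, hD⟩ := exists_lintegral_le_of_weak h0 h1 (C := C + 1) (by positivity)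
  refine ⟨D, fun J hJ y => ?_⟩
  have := hD (μ.restrict J) (by simpa using hJ) (fun x => k (x - y)) (by fun_prop) fun t => ?_
  · simpa using this
  · refine le_trans ?_ ((hK y t).trans ?_)
    · gcongr; exact Measure.restrict_le_self
    · simp

/-! ### Superlevel sets and their components -/

/-- Fatou's lemma along the neighbourhood filter of x. It makes the superlevel sets open, so that
they split into intervals. -/
theorem lowerSemicontinuous_lpotential {μ : Measure ℝ} {k g : ℝ → ℝ≥0∞}
    (hk : LowerSemicontinuous k) (hg : Measurable g) :
    LowerSemicontinuous (lpotential μ k g) := by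
  rw [lowerSemicontinuous_iff_le_liminf]
  intro x
  have hkm : Measurable k := hk.measurable
  refine le_trans (lintegral_mono fun y => ?_) (lintegral_liminf_le fun z => by fun_prop)
  have h1 : LowerSemicontinuous fun z => k (z - y) :=
    LowerSemicontinuous.comp hk (by fun_prop)
  calc k (x - y) * g y ≤ liminf (fun z => k (z - y)) (nhds x) * g y := by
        gcongr
        exact LowerSemicontinuousAt.le_liminf (h1 x)
    _ = liminf (fun z => k (z - y)) (nhds x) * liminf (fun _ => g y) (nhds x) := by simp
    _ ≤ _ := ENNReal.le_liminf_mul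

/-- Every point of a bounded open set lies in an interval whose endpoints are outside the set. -/
theorem exists_component_Ioo {U : Set ℝ} (hU : IsOpen U) (hb : Bornology.IsBounded U) {x : ℝ}
    (hx : x ∈ U) : ∃ c d : ℝ, c ∉ U ∧ d ∉ U ∧ x ∈ Ioo c d ∧ Ioo c d ⊆ U := by
  obtain ⟨R, hR⟩ := hb.subset_closedBall 0
  have hout : ∀ y, R < |y| → y ∉ U := fun y hy hyU => by
    have := hR hyU
    simp at this
    linarith
  have hA : IsClosed (Iic x ∩ Uᶜ) := isClosed_Iic.inter hU.isClosed_compl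
  have hB : IsClosed (Ici x ∩ Uᶜ) := isClosed_Ici.inter hU.isClosed_compl
  have hAne : (Iic x ∩ Uᶜ).Nonempty := by
    refine ⟨-(|x| + |R| + 1), ?_, hout _ ?_⟩
    · have := neg_abs_le x; have := abs_nonneg R; simp only [mem_Iic]; linarith
    · rw [abs_neg, abs_of_nonneg (by positivity)]
      have := le_abs_self R; have := abs_nonneg x; linarith
  have hBne : (Ici x ∩ Uᶜ).Nonempty := by
    refine ⟨|x| + |R| + 1, ?_, hout _ ?_⟩
    · have := le_abs_self x; have := abs_nonneg R; simp only [mem_Ici]; linarith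
    · rw [abs_of_nonneg (by positivity)]
      have := le_abs_self R; have := abs_nonneg x; linarith
  have hAb : BddAbove (Iic x ∩ Uᶜ) := ⟨x, fun y hy => hy.1⟩
  have hBb : BddBelow (Ici x ∩ Uᶜ) := ⟨x, fun y hy => hy.1⟩
  have hc := hA.csSup_mem hAne hAb
  have hd := hB.csInf_mem hBne hBb
  refine ⟨_, _, hc.2, hd.2, ⟨?_, ?_⟩, ?_⟩
  · exact lt_of_le_of_ne hc.1 fun h => hc.2 (by rw [h]; exact hx)
  · exact lt_of_le_of_ne hd.1 fun h => hd.2 (by rw [← h]; exact hx)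
  · intro y hy
    by_contra hyU
    rcases le_total y x with h | h
    · exact absurd (le_csSup hAb ⟨h, hyU⟩) (not_le.2 hy.1)
    · exact absurd (csInf_le hBb ⟨h, hyU⟩) (not_le.2 hy.2)

/-- A measure estimate on every component of a bounded open set sums up. -/
theorem measure_le_of_forall_component {ρ : Measure ℝ} {U E F : Set ℝ} (hU : IsOpen U)
    (hb : Bornology.IsBounded U) (hEU : E ⊆ U) {ε : ℝ≥0∞}
    (h : ∀ c d : ℝ, c ∉ U → d ∉ U → Ioo c d ⊆ U → (¬ Ioo c d ⊆ F) →
      ρ (E ∩ Ioo c d) ≤ ε * ρ (Ioo c d)) :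
    ρ E ≤ ε * ρ U + ρ F := by
  set S : Set (ℝ × ℝ) := {z | z.1 < z.2 ∧ z.1 ∉ U ∧ z.2 ∉ U ∧ Ioo z.1 z.2 ⊆ U ∧
    ¬ Ioo z.1 z.2 ⊆ F} with hS
  -- If two such intervals met without coinciding, an endpoint of one would lie inside the other,
  -- hence in U.
  have hdisj : S.PairwiseDisjoint fun z => Ioo z.1 z.2 := by
    rintro ⟨c, d⟩ ⟨-, hc, hd, hcd, -⟩ ⟨c', d'⟩ ⟨-, hc', hd', hcd', -⟩ hne
    rw [Function.onFun, disjoint_left]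
    rintro x ⟨hx1, hx2⟩ ⟨hx3, hx4⟩
    dsimp only at *
    refine hne (Prod.ext ?_ ?_)
    · rcases lt_trichotomy c c' with h | h | h
      · exact absurd (hcd ⟨h, hx3.trans hx2⟩) hc'
      · exact h
      · exact absurd (hcd' ⟨h, hx1.trans hx4⟩) hc
    · rcases lt_trichotomy d d' with h | h | h
      · exact absurd (hcd' ⟨hx3.trans hx2, h⟩) hd
      · exact h
      · exact absurd (hcd ⟨hx1.trans hx4, h⟩) hd'
  have hcount : S.Countable := hdisj.countable_of_isOpen (fun _ _ => isOpen_Ioo)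
    fun z hz => nonempty_Ioo.2 hz.1
  have hcover : E ⊆ (⋃ z ∈ S, E ∩ Ioo z.1 z.2) ∪ F := by
    intro x hx
    obtain ⟨c, d, hc, hd, hxcd, hcd⟩ := exists_component_Ioo hU hb (hEU hx)
    by_cases hF : Ioo c d ⊆ F
    · exact Or.inr (hF hxcd)
    · refine Or.inl (mem_biUnion (x := (c, d)) ⟨hxcd.1.trans hxcd.2, hc, hd, hcd, hF⟩ ⟨hx, hxcd⟩)
  calc ρ E ≤ ρ (⋃ z ∈ S, E ∩ Ioo z.1 z.2) + ρ F :=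
        (measure_mono hcover).trans (measure_union_le _ _)
    _ ≤ ∑' z : S, ε * ρ (Ioo z.1.1 z.1.2) + ρ F := by
        gcongr
        refine (measure_biUnion_le ρ hcount _).trans (ENNReal.tsum_le_tsum fun z => ?_)
        obtain ⟨-, h2, h3, h4, h5⟩ := z.2
        exact h _ _ h2 h3 h4 h5
    _ ≤ ε * ρ U + ρ F := by
        rw [ENNReal.tsum_mul_left, ← measure_biUnion hcount hdisj fun _ _ => measurableSet_Ioo]
        gcongr
        exact iUnion₂_subset fun z hz => hz.2.2.2.1

/-! ### The good-λ inequality -/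

/-- Chebyshev estimate for the potential on a component `(c, d)` of `{Kg > t}`. -/
theorem measure_component_le {μ : Measure ℝ} [SFinite μ] {k g m : ℝ → ℝ≥0∞} {θ : ℝ} {D γ t : ℝ≥0}
    (hk_even : ∀ x, k (-x) = k x) (hk_anti : AntitoneOn k (Ici 0)) (hk : Measurable k)
    (hg : Measurable g) (h1 : θ < 1) (hθ : 0 < θ)
    (hD : ∀ J : Set ℝ, μ J ≠ ∞ → ∀ y : ℝ, ∫⁻ x in J, k (x - y) ∂μ ≤ D * μ J ^ (1 - θ))
    (hm : DominatesAverages μ θ g m) (ht : 0 < t) {c d : ℝ} (hμ : μ (Ioo c d) ≠ ∞)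
    (hc : lpotential μ k g c ≤ t) (hd : lpotential μ k g d ≤ t)
    {x₁ : ℝ} (hx₁ : x₁ ∈ Ioo c d) (hmx : m x₁ ≤ γ * t) :
    μ ({x | ((3 * t : ℝ≥0) : ℝ≥0∞) < lpotential μ k g x} ∩ Ioo c d) ≤
      ((D * γ : ℝ≥0) : ℝ≥0∞) * μ (Ioo c d) := by
  set J := Ioo c d with hJ
  -- Moving x to c increases k(x - y) for y ≤ c, and moving it to d does so for y ≥ d. The two outer
  -- parts thus cost at most 2t of the 3t.
  have hsub : {x | ((3 * t : ℝ≥0) : ℝ≥0∞) < lpotential μ k g x} ∩ J ⊆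
      {x | (t : ℝ≥0∞) ≤ ∫⁻ y in J, k (x - y) * g y ∂μ} ∩ J := by
    rintro x ⟨hx, hxJ⟩
    refine ⟨?_, hxJ⟩
    rw [mem_ofPred_eq] at hx ⊢
    by_contra! hlt
    have hcov : (univ : Set ℝ) ⊆ Iic c ∪ (J ∪ Ici d) := by
      intro y _
      by_cases h1 : y ≤ c
      · exact Or.inl h1
      by_cases h2 : d ≤ y
      · exact Or.inr (Or.inr h2)
      · exact Or.inr (Or.inl ⟨not_le.1 h1, not_le.1 h2⟩)
    have hle : lpotential μ k g x ≤ t + (t + t) := by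
      calc lpotential μ k g x = ∫⁻ y in univ, k (x - y) * g y ∂μ := by
            rw [setLIntegral_univ]; rfl
        _ ≤ ∫⁻ y in Iic c ∪ (J ∪ Ici d), k (x - y) * g y ∂μ := lintegral_mono_set hcov
        _ ≤ ∫⁻ y in Iic c, k (x - y) * g y ∂μ + (∫⁻ y in J, k (x - y) * g y ∂μ +
              ∫⁻ y in Ici d, k (x - y) * g y ∂μ) :=
            (lintegral_union_le _ _ _).trans (by gcongr; exact lintegral_union_le _ _ _)
        _ ≤ ∫⁻ y in Iic c, k (c - y) * g y ∂μ + (t +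
              ∫⁻ y in Ici d, k (d - y) * g y ∂μ) := by
            gcongr ?_ + (?_ + ?_)
            · refine setLIntegral_mono' measurableSet_Iic fun y hy => ?_
              gcongr
              refine kernel_le_of_abs_le hk_even hk_anti ?_
              have := hxJ.1; simp only [mem_Iic] at hy
              rw [abs_of_nonneg (by linarith), abs_of_nonneg (by linarith)]; linarith
            · refine setLIntegral_mono' measurableSet_Ici fun y hy => ?_
              gcongr
              refine kernel_le_of_abs_le hk_even hk_anti ?_
              have := hxJ.2; simp only [mem_Ici] at hy
              rw [abs_of_nonpos (by linarith), abs_of_nonpos (by linarith)]; linarith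
        _ ≤ t + (t + t) := by
            gcongr
            · exact (setLIntegral_le_lintegral _ _).trans hc
            · exact (setLIntegral_le_lintegral _ _).trans hd
    refine absurd (hx.trans_le hle) (not_lt.2 ?_)
    norm_cast
    refine le_of_eq ?_
    ring
  have hF : Measurable (Function.uncurry fun x y => k (x - y) * g y) := by
    simp only [Function.uncurry_def]; fun_prop
  -- After Tonelli the inner integral is that of `k` over J, bounded by D μ(J)^(1-θ); the point x₁
  -- bounds ∫_J g by γ t μ(J)^θ, and the powers combine to μ(J).
  have hcheb : (t : ℝ≥0∞) * μ ({x | ((3 * t : ℝ≥0) : ℝ≥0∞) < lpotential μ k g x} ∩ J) ≤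
      ((D * γ : ℝ≥0) : ℝ≥0∞) * μ J * t := by
    calc (t : ℝ≥0∞) * μ ({x | ((3 * t : ℝ≥0) : ℝ≥0∞) < lpotential μ k g x} ∩ J)
        ≤ t * μ.restrict J {x | (t : ℝ≥0∞) ≤ ∫⁻ y in J, k (x - y) * g y ∂μ} := by
          rw [Measure.restrict_apply' measurableSet_Ioo]
          gcongr
      _ ≤ ∫⁻ x in J, ∫⁻ y in J, k (x - y) * g y ∂μ ∂μ :=
          mul_meas_ge_le_lintegral hF.lintegral_prod_right' _
      _ = ∫⁻ y in J, ∫⁻ x in J, k (x - y) * g y ∂μ ∂μ :=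
          lintegral_lintegral_swap hF.aemeasurable
      _ ≤ ∫⁻ y in J, D * μ J ^ (1 - θ) * g y ∂μ := by
          refine lintegral_mono fun y => ?_
          rw [lintegral_mul_const _ (by fun_prop)]
          gcongr
          exact hD J hμ y
      _ = D * μ J ^ (1 - θ) * ∫⁻ y in J, g y ∂μ := lintegral_const_mul _ hg
      _ ≤ D * μ J ^ (1 - θ) * (γ * t * μ J ^ θ) := by
          gcongr
          refine (hm J ordConnected_Ioo (Metric.isBounded_Ioo c d) x₁ hx₁).trans ?_
          gcongr
      _ = D * γ * (μ J ^ (1 - θ) * μ J ^ θ) * t := by ring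
      _ = _ := by
          rw [← ENNReal.rpow_add_of_nonneg _ _ (by linarith) hθ.le, sub_add_cancel,
            ENNReal.rpow_one]
          push_cast; ring
  rw [mul_comm] at hcheb
  exact (ENNReal.mul_le_mul_iff_left (by exact_mod_cast ht.ne') (by simp)).1 hcheb

theorem le_weakSup {ρ : Measure ℝ} {κ : ℝ} {g : ℝ → ℝ≥0∞} {t : ℝ≥0} (ht : 0 < t) :
    (t : ℝ≥0∞) ^ κ * ρ {x | (t : ℝ≥0∞) < g x} ≤ weakSup ρ κ g :=
  le_iSup₂ (f := fun (t : ℝ≥0) (_ : 0 < t) => (t : ℝ≥0∞) ^ κ * ρ {x | (t : ℝ≥0∞) < g x}) t ht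

theorem measure_lt_top_of_weakSup {ρ : Measure ℝ} {κ : ℝ} {g : ℝ → ℝ≥0∞}
    (h : weakSup ρ κ g ≠ ∞) {t : ℝ≥0} (ht : 0 < t) : ρ {x | (t : ℝ≥0∞) < g x} < ∞ := by
  by_contra! h'
  refine h (top_unique (le_trans ?_ (le_weakSup ht)))
  rw [top_le_iff.1 h', ENNReal.mul_top]
  rw [← ENNReal.coe_rpow_of_ne_zero ht.ne']
  simp [NNReal.rpow_eq_zero_iff, ht.ne']

/-- Far from the support of `g`, the potential is dominated by the maximal function. -/
theorem lpotential_le_of_far {μ : Measure ℝ} {k g m : ℝ → ℝ≥0∞} {θ : ℝ} {C : ℝ≥0∞}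
    (hk_even : ∀ x, k (-x) = k x) (hk_anti : AntitoneOn k (Ici 0)) (hθ : 0 ≤ θ)
    (hK : WeakKernel μ k θ C) (hg : Measurable g)
    (hm : DominatesAverages μ θ g m) {a b s x : ℝ} (hs : 0 ≤ s)
    (hab : b - a ≤ 2 * s) (hx : x ∈ Icc a b)
    (hsupp : ∀ y, g y ≠ 0 → y ∈ Icc a b ∧ s ≤ |x - y|) :
    lpotential μ k g x ≤ C * m x := by
  have hball : Icc a b ⊆ Metric.closedBall ((a + b) / 2) s := by
    intro y hy
    rw [Metric.mem_closedBall, Real.dist_eq, abs_le]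
    constructor <;> linarith [hy.1, hy.2]
  calc lpotential μ k g x ≤ ∫⁻ y, (Icc a b).indicator (fun y => k s * g y) y ∂μ := by
        refine lintegral_mono fun y => ?_
        by_cases hy : g y = 0
        · simp [hy]
        · obtain ⟨h1, h2⟩ := hsupp y hy
          simp only [indicator_of_mem h1]
          gcongr
          exact kernel_le_of_abs_le hk_even hk_anti (by rwa [abs_of_nonneg hs])
    _ = ∫⁻ y in Icc a b, k s * g y ∂μ := lintegral_indicator measurableSet_Icc _
    _ ≤ k s * (m x * μ (Icc a b) ^ θ) := by
        rw [lintegral_const_mul _ hg]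
        gcongr
        exact hm _ ordConnected_Icc (Metric.isBounded_Icc a b) x hx
    _ ≤ k s * μ (Metric.closedBall ((a + b) / 2) s) ^ θ * m x := by
        rw [mul_assoc, mul_comm (m x)]
        gcongr
    _ ≤ C * m x := by
        gcongr
        exact kernel_mul_measure_closedBall_le hk_even hk_anti hθ hK _ hs

theorem exists_nat_lt_measure_closedBall {μ : Measure ℝ} (hμ : μ univ = ∞) {M : ℝ≥0∞}
    (hM : M < ∞) : ∃ n : ℕ, M < μ (Metric.closedBall 0 (n : ℝ)) := by
  have hmono : Monotone fun n : ℕ => Metric.closedBall (0 : ℝ) (n : ℝ) := fun i j hij =>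
    Metric.closedBall_subset_closedBall (by exact_mod_cast hij)
  rw [← hμ, ← Metric.iUnion_closedBall_nat (0 : ℝ), hmono.measure_iUnion] at hM
  exact lt_iSup_iff.1 hM

/-- At distance at least n from the support, Kg ≤ k(n) ∫ g, and k(n) is at most of order
μ(B(0,n))^(-θ), which tends to 0 because μ is infinite. -/
theorem isBounded_superlevel {μ : Measure ℝ} {k g : ℝ → ℝ≥0∞} {θ : ℝ} {C : ℝ≥0}
    (hk_even : ∀ x, k (-x) = k x) (hk_anti : AntitoneOn k (Ici 0)) (hθ : 0 < θ)
    (hK : WeakKernel μ k θ C) (hμ : μ univ = ∞) (hg : Measurable g) {N : ℝ}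
    (hsupp : ∀ y, g y ≠ 0 → |y| ≤ N) (hG : ∫⁻ y, g y ∂μ ≠ ∞) {t : ℝ≥0} (ht : 0 < t) :
    Bornology.IsBounded {x | (t : ℝ≥0∞) < lpotential μ k g x} := by
  set G := ∫⁻ y, g y ∂μ with hGdef
  have ht' : (t : ℝ≥0∞) ≠ 0 := by exact_mod_cast ht.ne'
  have hfin : ((C * G / t) ^ (1 / θ) : ℝ≥0∞) < ∞ :=
    ENNReal.rpow_lt_top_of_nonneg (by positivity)
      (ENNReal.div_ne_top (ENNReal.mul_ne_top ENNReal.coe_ne_top hG) ht')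
  obtain ⟨n, hn⟩ := exists_nat_lt_measure_closedBall hμ hfin
  have hn2 : C * G / t ≤ μ (Metric.closedBall 0 (n : ℝ)) ^ θ := by
    have := ENNReal.rpow_le_rpow hn.le hθ.le
    rwa [← ENNReal.rpow_mul, one_div_mul_cancel hθ.ne', ENNReal.rpow_one] at this
  have hn0 : μ (Metric.closedBall 0 (n : ℝ)) ^ θ ≠ 0 := by
    rw [Ne, ENNReal.rpow_eq_zero_iff_of_pos hθ]
    exact (pos_of_gt hn).ne'
  have hkn := kernel_mul_measure_closedBall_le hk_even hk_anti hθ.le hK 0 (Nat.cast_nonneg n)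
  refine (Metric.isBounded_closedBall (x := (0 : ℝ)) (r := N + n)).subset fun x hx => ?_
  by_contra hxn
  rw [Metric.mem_closedBall, dist_zero_right, Real.norm_eq_abs, not_le] at hxn
  refine absurd (show (t : ℝ≥0∞) < lpotential μ k g x from hx) (not_lt.2 ?_)
  have h1 : lpotential μ k g x ≤ k n * G := by
    rw [hGdef, ← lintegral_const_mul _ hg]
    refine lintegral_mono fun y => ?_
    by_cases hy : g y = 0
    · simp [hy]
    · gcongr
      refine kernel_le_of_abs_le hk_even hk_anti ?_
      have h2 := hsupp y hy
      have h3 := abs_sub_abs_le_abs_sub x y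
      rw [Nat.abs_cast]; linarith
  rcases eq_or_ne G 0 with h0 | h0
  · rw [h0, mul_zero] at h1
    exact h1.trans zero_le
  refine h1.trans ?_
  set W := μ (Metric.closedBall 0 (n : ℝ)) ^ θ
  rcases eq_or_ne W ∞ with hW | hW
  · have hk0 : k n = 0 := by
      by_contra hne
      rw [hW, ENNReal.mul_top hne] at hkn
      exact absurd hkn (by simp)
    simp [hk0]
  · rw [ENNReal.div_le_iff_le_mul (Or.inl ht') (Or.inl ENNReal.coe_ne_top)] at hn2
    have h4 : k n * G * W ≤ t * W :=
      calc k n * G * W = k n * W * G := by ring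
        _ ≤ C * G := by gcongr
        _ ≤ W * t := hn2
        _ = t * W := mul_comm _ _
    exact (ENNReal.mul_le_mul_iff_left hn0 hW).1 h4

/-- The good-`λ` inequality for functions of bounded support. -/
theorem good_lambda {μ ρ : Measure ℝ} [IsLocallyFiniteMeasure μ] {k g m : ℝ → ℝ≥0∞} {θ : ℝ}
    {C D γ t ε δ : ℝ≥0} (hk_even : ∀ x, k (-x) = k x) (hk_anti : AntitoneOn k (Ici 0))
    (hk : LowerSemicontinuous k) (hθ : 0 < θ) (h1 : θ < 1) (hK : WeakKernel μ k θ C)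
    (hμ : μ univ = ∞)
    (hD : ∀ J : Set ℝ, μ J ≠ ∞ → ∀ y : ℝ, ∫⁻ x in J, k (x - y) ∂μ ≤ D * μ J ^ (1 - θ))
    (hδ : ∀ I : Set ℝ, I.OrdConnected → ∀ E : Set ℝ, MeasurableSet E → E ⊆ I →
      μ E ≤ (δ : ℝ≥0∞) * μ I → ρ E ≤ (ε : ℝ≥0∞) * ρ I)
    (hγ : D * γ ≤ δ) (hg : Measurable g) (hm : DominatesAverages μ θ g m) {N : ℝ}
    (hsupp : ∀ y, g y ≠ 0 → |y| ≤ N) (hG : ∫⁻ y, g y ∂μ ≠ ∞) (ht : 0 < t) :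
    ρ {x | ((3 * t : ℝ≥0) : ℝ≥0∞) < lpotential μ k g x} ≤
      ε * ρ {x | (t : ℝ≥0∞) < lpotential μ k g x} +
        ρ {x | ((γ * t : ℝ≥0) : ℝ≥0∞) < m x} := by
  have hlsc := lowerSemicontinuous_lpotential (μ := μ) hk hg
  refine measure_le_of_forall_component (hlsc.isOpen_preimage _)
    (isBounded_superlevel hk_even hk_anti hθ hK hμ hg hsupp hG ht) (fun x hx => ?_)
    fun c d hc hd _ hF => ?_
  · refine lt_of_le_of_lt ?_ (show ((3 * t : ℝ≥0) : ℝ≥0∞) < lpotential μ k g x from hx)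
    norm_cast
    exact le_mul_of_one_le_left t.2 (by norm_num)
  · obtain ⟨x₁, hx₁, hmx⟩ := not_subset.1 hF
    refine hδ _ ordConnected_Ioo _
      ((hlsc.isOpen_preimage _).measurableSet.inter measurableSet_Ioo) inter_subset_right ?_
    refine (measure_component_le hk_even hk_anti hk.measurable hg h1 hθ hD hm ht
      measure_Ioo_lt_top.ne (not_lt.1 hc) (not_lt.1 hd) hx₁ (not_lt.1 hmx)).trans ?_
    gcongr

/-! ### From good-λ to the weak norm -/

/-- Absorption: the good-λ inequality bounds the supremum by half of itself plus the desired term.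
The hypotheses on `B` serve only to make that supremum finite, so neither `B` nor `C` enters the
constant. -/
theorem weakSup_le_of_good_lambda {ρ : Measure ℝ} {h m : ℝ → ℝ≥0∞} {C γ ε : ℝ≥0} {κ : ℝ}
    {B : Set ℝ} (hκ : 0 < κ) (hC : 0 < C) (hγ : 0 < γ) (hε : 3 ^ κ * ε ≤ 2⁻¹)
    (hB : ρ B ≠ ∞) (hfar : ∀ x ∉ B, h x ≤ C * m x) (hm : weakSup ρ κ m ≠ ∞)
    (hgood : ∀ t : ℝ≥0, 0 < t → ρ {x | ((3 * t : ℝ≥0) : ℝ≥0∞) < h x} ≤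
      ε * ρ {x | (t : ℝ≥0∞) < h x} + ρ {x | ((γ * t : ℝ≥0) : ℝ≥0∞) < m x}) :
    weakSup ρ κ h ≤ ((2 * (3 / γ) ^ κ : ℝ≥0) : ℝ≥0∞) * weakSup ρ κ m := by
  set R := weakSup ρ κ m with hR
  refine iSup₂_le fun T hT => ?_
  -- Capping the levels at T makes the supremum finite; the cap survives the step from t = 3s to s ≤
  -- t.
  set S : ℝ≥0∞ := ⨆ (t : ℝ≥0) (_ : 0 < t ∧ t ≤ T), (t : ℝ≥0∞) ^ κ * ρ {x | (t : ℝ≥0∞) < h x}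
    with hS
  have hle : ∀ t : ℝ≥0, 0 < t → t ≤ T → (t : ℝ≥0∞) ^ κ * ρ {x | (t : ℝ≥0∞) < h x} ≤ S :=
    fun t h1 h2 => le_iSup₂ (f := fun (t : ℝ≥0) (_ : 0 < t ∧ t ≤ T) =>
      (t : ℝ≥0∞) ^ κ * ρ {x | (t : ℝ≥0∞) < h x}) t ⟨h1, h2⟩
  refine (hle T hT le_rfl).trans ?_
  have hSfin : S ≠ ∞ := by
    have hbd : S ≤ (T : ℝ≥0∞) ^ κ * ρ B + (C : ℝ≥0∞) ^ κ * R := by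
      refine iSup₂_le fun t ht => ?_
      have hsub : {x | (t : ℝ≥0∞) < h x} ⊆ B ∪ {x | ((t / C : ℝ≥0) : ℝ≥0∞) < m x} := by
        intro x hx
        by_cases hxB : x ∈ B
        · exact Or.inl hxB
        · refine Or.inr ?_
          have h3 : (t : ℝ≥0∞) < C * m x := lt_of_lt_of_le hx (hfar x hxB)
          change ((t / C : ℝ≥0) : ℝ≥0∞) < m x
          rw [ENNReal.coe_div hC.ne']
          exact ENNReal.div_lt_of_lt_mul' h3
      have htC : (t : ℝ≥0∞) ^ κ = (C : ℝ≥0∞) ^ κ * ((t / C : ℝ≥0) : ℝ≥0∞) ^ κ := by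
        rw [← ENNReal.mul_rpow_of_nonneg _ _ hκ.le, ← ENNReal.coe_mul, mul_div_cancel₀ _ hC.ne']
      calc (t : ℝ≥0∞) ^ κ * ρ {x | (t : ℝ≥0∞) < h x}
          ≤ (t : ℝ≥0∞) ^ κ * (ρ B + ρ {x | ((t / C : ℝ≥0) : ℝ≥0∞) < m x}) := by
            gcongr
            exact (measure_mono hsub).trans (measure_union_le _ _)
        _ = (t : ℝ≥0∞) ^ κ * ρ B + (C : ℝ≥0∞) ^ κ * (((t / C : ℝ≥0) : ℝ≥0∞) ^ κ *
              ρ {x | ((t / C : ℝ≥0) : ℝ≥0∞) < m x}) := by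
            rw [mul_add, ← mul_assoc ((C : ℝ≥0∞) ^ κ), ← htC]
        _ ≤ _ := by
            gcongr
            · exact ht.2
            · exact le_weakSup (div_pos ht.1 hC)
    refine ne_top_of_le_ne_top ?_ hbd
    exact ENNReal.add_ne_top.2 ⟨ENNReal.mul_ne_top (by simp [hκ.le]) hB,
      ENNReal.mul_ne_top (by simp [hκ.le]) hm⟩
  have habs : S ≤ 2⁻¹ * S + (((3 / γ) ^ κ : ℝ≥0) : ℝ≥0∞) * R := by
    refine iSup₂_le fun t ht => ?_
    obtain ⟨s, rfl⟩ : ∃ s : ℝ≥0, t = 3 * s := ⟨t / 3, by field_simp⟩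
    have hs : 0 < s := pos_of_mul_pos_right ht.1 (by norm_num)
    have hsT : s ≤ T := le_trans (le_mul_of_one_le_left s.2 (by norm_num)) ht.2
    have e1 : ((3 * s : ℝ≥0) : ℝ≥0∞) ^ κ = 3 ^ κ * (s : ℝ≥0∞) ^ κ := by
      rw [ENNReal.coe_mul, ENNReal.mul_rpow_of_nonneg _ _ hκ.le]; rfl
    have e2 : ((3 * s : ℝ≥0) : ℝ≥0∞) ^ κ =
        (((3 / γ) ^ κ : ℝ≥0) : ℝ≥0∞) * ((γ * s : ℝ≥0) : ℝ≥0∞) ^ κ := by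
      rw [ENNReal.coe_rpow_of_nonneg _ hκ.le, ← ENNReal.mul_rpow_of_nonneg _ _ hκ.le,
        ← ENNReal.coe_mul]
      congr 2
      field_simp
    calc ((3 * s : ℝ≥0) : ℝ≥0∞) ^ κ * ρ {x | ((3 * s : ℝ≥0) : ℝ≥0∞) < h x}
        ≤ ((3 * s : ℝ≥0) : ℝ≥0∞) ^ κ * (ε * ρ {x | (s : ℝ≥0∞) < h x} +
            ρ {x | ((γ * s : ℝ≥0) : ℝ≥0∞) < m x}) := by gcongr; exact hgood s hs
      _ = 3 ^ κ * ε * ((s : ℝ≥0∞) ^ κ * ρ {x | (s : ℝ≥0∞) < h x}) +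
          (((3 / γ) ^ κ : ℝ≥0) : ℝ≥0∞) * (((γ * s : ℝ≥0) : ℝ≥0∞) ^ κ *
            ρ {x | ((γ * s : ℝ≥0) : ℝ≥0∞) < m x}) := by
          rw [mul_add, ← mul_assoc (((3 / γ) ^ κ : ℝ≥0) : ℝ≥0∞), ← e2, e1]
          ring
      _ ≤ _ := by
          gcongr
          · have : ((3 ^ κ * ε : ℝ≥0) : ℝ≥0∞) ≤ ((2⁻¹ : ℝ≥0) : ℝ≥0∞) := by exact_mod_cast hε
            rw [ENNReal.coe_mul, ENNReal.coe_rpow_of_nonneg _ hκ.le,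
              ENNReal.coe_inv (by norm_num)] at this
            exact this
          · exact hle s hs hsT
          · exact le_weakSup (mul_pos hγ hs)
  have hhalf : 2⁻¹ * S + 2⁻¹ * S = S := by
    rw [← add_mul, ENNReal.inv_two_add_inv_two, one_mul]
  have hfin2 : 2⁻¹ * S ≠ ∞ := ENNReal.mul_ne_top (by simp) hSfin
  have h5 : 2⁻¹ * S ≤ (((3 / γ) ^ κ : ℝ≥0) : ℝ≥0∞) * R := by
    rw [← hhalf] at habs
    conv at habs => rhs; rw [hhalf]
    exact (ENNReal.add_le_add_iff_left hfin2).1 habs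
  calc S = 2⁻¹ * S + 2⁻¹ * S := hhalf.symm
    _ ≤ (((3 / γ) ^ κ : ℝ≥0) : ℝ≥0∞) * R + (((3 / γ) ^ κ : ℝ≥0) : ℝ≥0∞) * R := by gcongr
    _ = _ := by push_cast; ring

/-! ### Size of ρ, local integrability and truncation -/

/-- Since μ is infinite, each ball is a negligible μ-fraction of a larger one, so it carries at most
half of ρ(ℝ). Exhausting ℝ gives ρ(ℝ) ≤ ρ(ℝ)/2. -/
theorem AInfty.measure_univ {μ ρ : Measure ℝ} [IsLocallyFiniteMeasure μ] (hρ : AInfty μ ρ)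
    (hμ : μ univ = ∞) : ρ univ = 0 ∨ ρ univ = ∞ := by
  obtain ⟨δ, hδ, h⟩ := hρ 2⁻¹ (by norm_num)
  have hball : ∀ n : ℕ, ρ (Metric.closedBall 0 (n : ℝ)) ≤ 2⁻¹ * ρ univ := by
    intro n
    have hfin : μ (Metric.closedBall 0 (n : ℝ)) / δ < ∞ :=
      ENNReal.div_lt_top (isCompact_closedBall (0 : ℝ) _).measure_lt_top.ne
        (by exact_mod_cast hδ.ne')
    obtain ⟨N, hN⟩ := exists_nat_lt_measure_closedBall hμ hfin
    have hle : μ (Metric.closedBall 0 (n : ℝ)) ≤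
        δ * μ (Metric.closedBall 0 ((max n N : ℕ) : ℝ)) := by
      rw [mul_comm, ← ENNReal.div_le_iff (by exact_mod_cast hδ.ne') ENNReal.coe_ne_top]
      refine hN.le.trans (measure_mono (Metric.closedBall_subset_closedBall ?_))
      exact_mod_cast le_max_right n N
    have h1 := h _ (by rw [Real.closedBall_eq_Icc]; exact ordConnected_Icc) _
      measurableSet_closedBall (Metric.closedBall_subset_closedBall
        (by exact_mod_cast le_max_left n N)) hle
    rw [ENNReal.coe_inv (by norm_num)] at h1
    exact h1.trans (by gcongr <;> simp)
  have hmono : Monotone fun n : ℕ => Metric.closedBall (0 : ℝ) (n : ℝ) := fun i j hij =>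
    Metric.closedBall_subset_closedBall (by exact_mod_cast hij)
  have h1 : ρ univ ≤ 2⁻¹ * ρ univ := by
    conv_lhs => rw [← Metric.iUnion_closedBall_nat (0 : ℝ), hmono.measure_iUnion]
    exact iSup_le hball
  by_contra! hne
  refine absurd h1 (not_le.2 ?_)
  rw [mul_comm, ← div_eq_mul_inv]
  exact ENNReal.half_lt_self hne.1 hne.2

theorem DominatesAverages.mono {μ : Measure ℝ} {θ : ℝ} {g g' m : ℝ → ℝ≥0∞}
    (hm : DominatesAverages μ θ g m) (h : ∀ x, g' x ≤ g x) : DominatesAverages μ θ g' m :=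
  fun I hI hb x hx => (lintegral_mono h).trans (hm I hI hb x hx)

theorem exists_pos_lintegral_closedBall {μ : Measure ℝ} {g : ℝ → ℝ≥0∞} (hg : Measurable g)
    (h : ∫⁻ y, g y ∂μ ≠ 0) : ∃ n : ℕ, 0 < ∫⁻ y in Metric.closedBall 0 (n : ℝ), g y ∂μ := by
  by_contra! h'
  refine h ?_
  rw [lintegral_eq_zero_iff hg]
  have : ∀ᵐ y ∂μ, ∀ n : ℕ, y ∈ Metric.closedBall (0 : ℝ) (n : ℝ) → g y = 0 := by
    rw [ae_all_iff]
    intro n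
    rw [← ae_restrict_iff' measurableSet_closedBall]
    exact (lintegral_eq_zero_iff hg).1 (le_antisymm (h' n) zero_le)
  filter_upwards [this] with y hy
  obtain ⟨n, hn⟩ := exists_nat_ge |y|
  exact hy n (by simpa using hn)

/-- One ball contains both x and some mass of `g`, which bounds `m` below uniformly. Finiteness of
the weak norm of `m` then makes ρ finite on bounded sets. -/
theorem exists_lt_of_dominatesAverages {μ : Measure ℝ} [IsLocallyFiniteMeasure μ] {θ : ℝ}
    (hθ : 0 ≤ θ) {g m : ℝ → ℝ≥0∞} (hm : DominatesAverages μ θ g m) {r : ℝ}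
    (hr : 0 < ∫⁻ y in Metric.closedBall 0 r, g y ∂μ) (R : ℝ) :
    ∃ t : ℝ≥0, 0 < t ∧ ∀ x, |x| ≤ R → (t : ℝ≥0∞) < m x := by
  set W := μ (Metric.closedBall 0 (max r R)) ^ θ with hW
  have hWfin : W ≠ ∞ := (ENNReal.rpow_lt_top_of_nonneg hθ
    (isCompact_closedBall (0 : ℝ) _).measure_lt_top.ne).ne
  obtain ⟨t, ht, htlt⟩ := ENNReal.exists_nnreal_pos_mul_lt hWfin hr.ne'
  refine ⟨t, ht, fun x hx => ?_⟩
  have h1 : ∫⁻ y in Metric.closedBall 0 r, g y ∂μ ≤ m x * W := by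
    refine (lintegral_mono_set (Metric.closedBall_subset_closedBall (le_max_left r R))).trans ?_
    refine hm _ ?_ Metric.isBounded_closedBall x ?_
    · rw [Real.closedBall_eq_Icc]; exact ordConnected_Icc
    · simpa using Or.inr hx
  by_contra! hle
  exact absurd (htlt.trans_le (h1.trans (by gcongr))) (lt_irrefl _)

theorem lintegral_closedBall_ne_top {μ : Measure ℝ} [IsLocallyFiniteMeasure μ] {θ : ℝ}
    (hθ : 0 ≤ θ) {g m : ℝ → ℝ≥0∞} (hm : DominatesAverages μ θ g m) {x : ℝ} (hx : m x ≠ ∞)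
    (r : ℝ) : ∫⁻ y in Metric.closedBall 0 r, g y ∂μ ≠ ∞ := by
  refine ne_top_of_le_ne_top (b := m x * μ (Metric.closedBall 0 (max r |x|)) ^ θ)
    (ENNReal.mul_ne_top hx (ENNReal.rpow_lt_top_of_nonneg hθ
      (isCompact_closedBall (0 : ℝ) _).measure_lt_top.ne).ne) ?_
  refine (lintegral_mono_set (Metric.closedBall_subset_closedBall (le_max_left r |x|))).trans ?_
  refine hm _ ?_ Metric.isBounded_closedBall x (by simp)
  rw [Real.closedBall_eq_Icc]; exact ordConnected_Icc

theorem weakSup_eq_zero_of_measure_univ {ρ : Measure ℝ} {κ : ℝ} {h : ℝ → ℝ≥0∞}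
    (hρ : ρ univ = 0) : weakSup ρ κ h = 0 := by
  simp [weakSup, Measure.measure_univ_eq_zero.1 hρ]

theorem weakSup_eq_zero_of_eq_zero {ρ : Measure ℝ} {κ : ℝ} {h : ℝ → ℝ≥0∞}
    (hh : ∀ x, h x = 0) : weakSup ρ κ h = 0 := by
  simp [weakSup, hh]

theorem lpotential_eq_zero {μ : Measure ℝ} {k g : ℝ → ℝ≥0∞} (hg : Measurable g)
    (h : ∫⁻ y, g y ∂μ = 0) (x : ℝ) : lpotential μ k g x = 0 := by
  rw [lintegral_eq_zero_iff hg] at h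
  rw [lpotential, lintegral_congr_ae (g := fun _ => 0), lintegral_zero]
  filter_upwards [h] with y hy
  simp [hy]

theorem lpotential_eq_iSup_truncation {μ : Measure ℝ} {k g : ℝ → ℝ≥0∞} (hk : Measurable k)
    (hg : Measurable g) (x : ℝ) : lpotential μ k g x =
      ⨆ n : ℕ, lpotential μ k ((Metric.closedBall (0 : ℝ) n).indicator g) x := by
  have hmono : Monotone fun (n : ℕ) y =>
      k (x - y) * (Metric.closedBall (0 : ℝ) n).indicator g y := by
    intro i j hij y
    dsimp only
    gcongr
  unfold lpotential
  rw [← lintegral_iSup (fun n => ?_) hmono]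
  · refine lintegral_congr fun y => ?_
    refine le_antisymm ?_ (iSup_le fun n => ?_)
    · obtain ⟨n, hn⟩ := exists_nat_ge |y|
      refine le_iSup_of_le n ?_
      rw [indicator_of_mem (by simpa using hn)]
    · gcongr
      exact indicator_le_self' (fun _ _ => zero_le) y
  · exact (hk.comp (by fun_prop)).mul (hg.indicator measurableSet_closedBall)

/-! ### The estimate for general nonnegative functions -/

/-- The weak norm of the potential is controlled by that of any function which dominates the
fractional averages. -/
theorem exists_weakSup_lpotential_le {μ ρ : Measure ℝ} [IsLocallyFiniteMeasure μ]
    {k : ℝ → ℝ≥0∞} {θ κ : ℝ} {C : ℝ≥0} (hk_even : ∀ x, k (-x) = k x)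
    (hk_anti : AntitoneOn k (Ici 0)) (hk : LowerSemicontinuous k) (hθ : 0 < θ) (h1 : θ < 1)
    (hK : WeakKernel μ k θ C) (hμ : μ univ = ∞) (hρ : AInfty μ ρ) (hκ : 0 < κ) :
    ∃ B : ℝ≥0, 0 < B ∧ ∀ g m : ℝ → ℝ≥0∞, Measurable g → DominatesAverages μ θ g m →
      weakSup ρ κ (lpotential μ k g) ≤ B * weakSup ρ κ m := by
  obtain ⟨D, hD⟩ := exists_setLIntegral_kernel_le hθ h1 hk.measurable hK
  -- Chosen so that 3^κ ε = 1/2, as absorption requires; γ below is then chosen so that Dγ ≤ δ, with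
  -- D + 1 avoiding division by zero.
  set ε : ℝ≥0 := (3 ^ κ)⁻¹ * 2⁻¹ with hε
  have h3 : (0 : ℝ≥0) < 3 ^ κ := NNReal.rpow_pos (by norm_num)
  obtain ⟨δ, hδ0, hδ⟩ := hρ ε (by positivity)
  set γ : ℝ≥0 := δ / (D + 1) with hγ
  have hγ0 : 0 < γ := by positivity
  have hDγ : D * γ ≤ δ := by
    rw [hγ, mul_div_assoc', div_le_iff₀ (by positivity), mul_comm]
    gcongr
    simp
  refine ⟨2 * (3 / γ) ^ κ, mul_pos (by norm_num) (NNReal.rpow_pos (by positivity)),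
    fun g m hg hm => ?_⟩
  rcases eq_or_ne (weakSup ρ κ m) ∞ with hR | hR
  · rw [hR, ENNReal.mul_top]
    · exact le_top
    · have : (2 * (3 / γ) ^ κ : ℝ≥0) ≠ 0 :=
        (mul_pos (by norm_num) (NNReal.rpow_pos (by positivity))).ne'
      exact_mod_cast this
  rcases hρ.measure_univ hμ with h0 | hinf
  · rw [weakSup_eq_zero_of_measure_univ h0]; exact zero_le
  rcases eq_or_ne (∫⁻ y, g y ∂μ) 0 with hg0 | hg0
  · rw [weakSup_eq_zero_of_eq_zero (lpotential_eq_zero hg hg0)]; exact zero_le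
  -- Otherwise {m > 1} is all of ℝ, whose ρ-measure is infinite.
  obtain ⟨x₁, hx₁⟩ : ∃ x, m x ≠ ∞ := by
    by_contra! hall
    have := measure_lt_top_of_weakSup hR (t := 1) one_pos
    simp [hall, hinf] at this
  obtain ⟨r, hr⟩ := exists_pos_lintegral_closedBall hg hg0
  have hρfin : ∀ R : ℝ, ρ (Metric.closedBall 0 R) ≠ ∞ := by
    intro R
    obtain ⟨t, ht, htm⟩ := exists_lt_of_dominatesAverages hθ.le hm hr R
    refine ((measure_mono fun x hx => ?_).trans_lt (measure_lt_top_of_weakSup hR ht)).ne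
    exact htm x (by simpa using hx)
  have hmain : ∀ n : ℕ, weakSup ρ κ
      (lpotential μ k ((Metric.closedBall (0 : ℝ) n).indicator g)) ≤
        ((2 * (3 / γ) ^ κ : ℝ≥0) : ℝ≥0∞) * weakSup ρ κ m := by
    intro n
    set gn := (Metric.closedBall (0 : ℝ) n).indicator g with hgn
    have hgnm : Measurable gn := hg.indicator measurableSet_closedBall
    have hmn : DominatesAverages μ θ gn m :=
      hm.mono fun x => indicator_le_self' (fun _ _ => zero_le) x
    have hsupp : ∀ y, gn y ≠ 0 → |y| ≤ n := fun y hy => by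
      simpa using mem_of_indicator_ne_zero hy
    have hGn : ∫⁻ y, gn y ∂μ ≠ ∞ := by
      rw [hgn, lintegral_indicator measurableSet_closedBall]
      exact lintegral_closedBall_ne_top hθ.le hm hx₁ n
    -- Radius 3n: for |x| > 3n the interval joining x to the far end of [-n,n] has length |x| + n ≤
    -- 2(|x| - n), twice the distance to that support interval. `C + 1` only ensures positivity.
    refine weakSup_le_of_good_lambda (C := C + 1) (ε := ε) (B := Metric.closedBall 0 (3 * n))
      hκ (by positivity) hγ0 ?_ (hρfin _) (fun x hx => ?_) hR fun t ht =>
        good_lambda hk_even hk_anti hk hθ h1 hK hμ hD hδ hDγ hgnm hmn hsupp hGn ht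
    · rw [hε, ← mul_assoc, mul_inv_cancel₀ h3.ne', one_mul]
    · rw [Metric.mem_closedBall, dist_zero_right, Real.norm_eq_abs, not_le] at hx
      have hn0 : (0 : ℝ) ≤ n := Nat.cast_nonneg n
      have hlt : lpotential μ k gn x ≤ C * m x := by
        rcases le_total 0 x with h | h
        · rw [abs_of_nonneg h] at hx
          refine lpotential_le_of_far (a := -n) (b := x) (s := x - n) hk_even hk_anti hθ.le hK
            hgnm hmn (by linarith) (by linarith) ⟨by linarith, le_rfl⟩ fun y hy => ?_
          have := abs_le.1 (hsupp y hy)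
          exact ⟨⟨this.1, by linarith⟩, le_trans (by linarith) (le_abs_self _)⟩
        · rw [abs_of_nonpos h] at hx
          refine lpotential_le_of_far (a := x) (b := n) (s := -x - n) hk_even hk_anti hθ.le hK
            hgnm hmn (by linarith) (by linarith) ⟨le_rfl, by linarith⟩ fun y hy => ?_
          have := abs_le.1 (hsupp y hy)
          exact ⟨⟨by linarith, this.2⟩, le_trans (by linarith) (neg_le_abs _)⟩
      refine hlt.trans ?_
      gcongr
      simp
  refine iSup₂_le fun t ht => ?_
  have hmono : Monotone fun n : ℕ => {x | (t : ℝ≥0∞) <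
      lpotential μ k ((Metric.closedBall (0 : ℝ) n).indicator g) x} := by
    intro i j hij x hx
    refine lt_of_lt_of_le hx (lintegral_mono fun y => ?_)
    gcongr
  have hUn : {x | (t : ℝ≥0∞) < lpotential μ k g x} = ⋃ n : ℕ, {x | (t : ℝ≥0∞) <
      lpotential μ k ((Metric.closedBall (0 : ℝ) n).indicator g) x} := by
    ext x
    simp only [mem_iUnion, mem_ofPred_eq]
    rw [lpotential_eq_iSup_truncation hk.measurable hg, lt_iSup_iff]
  rw [hUn, hmono.measure_iUnion, ENNReal.mul_iSup]
  exact iSup_le fun n => (le_weakSup ht).trans (hmain n)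

/-! ### Passage to the operator and the maximal function -/

theorem weakSup_mono {ρ : Measure ℝ} {κ : ℝ} {h h' : ℝ → ℝ≥0∞} (hle : ∀ x, h x ≤ h' x) :
    weakSup ρ κ h ≤ weakSup ρ κ h' := by
  unfold weakSup
  gcongr with t ht x
  exact hle x

theorem absPotential_le_lpotential (μ : Measure ℝ) (k : ℝ → ℝ≥0∞) (f : ℝ → ℂ) (x : ℝ) :
    absPotential μ k f x ≤ lpotential μ k (fun y => ‖f y‖ₑ) x := by
  unfold absPotential lpotential
  split_ifs with h
  · refine (enorm_integral_le_lintegral_enorm _).trans (lintegral_mono fun y => ?_)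
    rw [enorm_mul]
    gcongr
    rw [← ofReal_norm, Complex.norm_real, Real.norm_of_nonneg ENNReal.toReal_nonneg]
    exact ENNReal.ofReal_toReal_le
  · exact not_lt.1 h

theorem lpotential_congr_ae {μ : Measure ℝ} {k g g' : ℝ → ℝ≥0∞} (h : g =ᵐ[μ] g') (x : ℝ) :
    lpotential μ k g x = lpotential μ k g' x := by
  refine lintegral_congr_ae ?_
  filter_upwards [h] with y hy
  rw [hy]

/-- Hölder on I gives the power 1 - 1/q = (1/β - 1/q) + (1 - 1/β); the first summand is the
normalisation in the maximal function. -/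
theorem dominatesAverages_maximalFn {μ : Measure ℝ} [IsLocallyFiniteMeasure μ] {q β : ℝ≥0∞}
    (hq : 1 ≤ q) (hqβ : q ≤ β) {f : ℝ → ℂ} (hf : AEStronglyMeasurable f μ) :
    DominatesAverages μ (1 - (β⁻¹).toReal) (fun y => ‖f y‖ₑ) (maximalFn μ q β f) := by
  intro I hI hb x hx
  have hIfin : μ I < ∞ := hb.measure_lt_top
  rcases eq_or_ne (μ I) 0 with h0 | h0
  · rw [Measure.restrict_eq_zero.2 h0]; simp
  have hq0 : q ≠ 0 := (zero_lt_one.trans_le hq).ne'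
  have hle : (β⁻¹).toReal ≤ (q⁻¹).toReal :=
    ENNReal.toReal_mono (ENNReal.inv_ne_top.2 hq0) (ENNReal.inv_le_inv.2 hqβ)
  have hq1 : (q⁻¹).toReal ≤ 1 := by
    simpa using ENNReal.toReal_mono ENNReal.one_ne_top (ENNReal.inv_le_one.2 hq)
  set b := (β⁻¹).toReal
  set c := (q⁻¹).toReal with hc
  have hm : μ I ^ (b - c) * eLpNorm f q (μ.restrict I) ≤ maximalFn μ q β f x := by
    rw [← eLpNorm_indicator_eq_eLpNorm_restrict hI.measurableSet]
    exact le_iSup_of_le I (le_iSup_of_le hI (le_iSup_of_le hx (le_iSup_of_le hIfin le_rfl)))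
  have hH := eLpNorm_le_eLpNorm_mul_rpow_measure_univ hq hf.restrict (μ := μ.restrict I)
  rw [eLpNorm_one_eq_lintegral_enorm, Measure.restrict_apply_univ, ENNReal.toReal_one, div_one,
    one_div, ← ENNReal.toReal_inv, ← hc] at hH
  calc ∫⁻ y in I, ‖f y‖ₑ ∂μ ≤ eLpNorm f q (μ.restrict I) * μ I ^ (1 - c) := hH
    _ = μ I ^ (b - c) * eLpNorm f q (μ.restrict I) * μ I ^ (1 - b) := by
      rw [show 1 - c = (b - c) + (1 - b) by ring, ENNReal.rpow_add _ _ h0 hIfin.ne]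
      ring
    _ ≤ _ := by gcongr

/-- The endpoint in which every average of `g` is dominated without a power of the measure. -/
theorem weakSup_lpotential_le_of_dominatesAverages_zero {μ ρ : Measure ℝ}
    [IsLocallyFiniteMeasure μ] {k g m : ℝ → ℝ≥0∞}
    {κ : ℝ} (hμ : μ univ = ∞) (hρ : AInfty μ ρ) (hg : Measurable g)
    (hm : DominatesAverages μ 0 g m) :
    weakSup ρ κ (lpotential μ k g) ≤ weakSup ρ κ m := by
  rcases hρ.measure_univ hμ with h0 | hinf
  · rw [weakSup_eq_zero_of_measure_univ h0]; exact zero_le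
  rcases eq_or_ne (∫⁻ y, g y ∂μ) 0 with hg0 | hg0
  · rw [weakSup_eq_zero_of_eq_zero (lpotential_eq_zero hg hg0)]; exact zero_le
  obtain ⟨r, hr⟩ := exists_pos_lintegral_closedBall hg hg0
  obtain ⟨t, ht, htlt⟩ := ENNReal.lt_iff_exists_nnreal_btwn.1 hr
  -- With exponent 0 the size of the ball is irrelevant, so the same t works for every x and {m > t}
  -- is all of ℝ.
  have hall : ∀ x, (t : ℝ≥0∞) < m x := by
    intro x
    refine htlt.trans_le ((lintegral_mono_set (Metric.closedBall_subset_closedBall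
      (le_max_left (r : ℝ) |x|))).trans ?_)
    have := hm (Metric.closedBall 0 (max (r : ℝ) |x|))
      (by rw [Real.closedBall_eq_Icc]; exact ordConnected_Icc) Metric.isBounded_closedBall x
      (by simp)
    simpa using this
  have htop : weakSup ρ κ m = ∞ := by
    by_contra hne
    have := measure_lt_top_of_weakSup hne (t := t) (by exact_mod_cast ht)
    simp [hall, hinf] at this
  rw [htop]
  exact le_top

end PotentialControl

/-! ### The theorem -/

open PotentialControl in
theorem mainTheorem2
    (μ : Measure ℝ) [IsLocallyFiniteMeasure μ] [NullSingletonClass μ]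
    (hμ_left : ∀ a : ℝ, μ (Iio a) = ∞) (hμ_right : ∀ a : ℝ, μ (Ici a) = ∞)
    (x₀ : ℝ) (a : ℝ → ℤ → ℝ) (ha : PotentialControl.IsPartitionSystem μ x₀ a)
    (q β p η : ℝ≥0∞) (hq : 1 ≤ q) (hqβ : q ≤ β) (hβ : β < ∞)
    (hp : p⁻¹ + β⁻¹ = q⁻¹) (hη : η⁻¹ + β⁻¹ = 1)
    (k : ℝ → ℝ≥0∞) (hk_even : ∀ x, k (-x) = k x) (hk_anti : AntitoneOn k (Ici 0))
    (hk_left : (⨆ x : ℝ, PotentialControl.weakNorm μ η (fun y => k (x - y))) < ∞)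
    (hk_right : (⨆ y : ℝ, PotentialControl.weakNorm μ η (fun x => k (x - y))) < ∞)
    (hk_lsc : LowerSemicontinuous k)
    (C₀ : ℝ≥0)
    (hC₀ : limsup (fun r : ℝ => ⨆ t : ℝ, μ (Icc t (t + r)) / μ (Icc 0 r)) atTop ≤ C₀)
    (hC₀' : limsup (fun r : ℝ => ⨆ t : ℝ, μ (Icc (t - r) t) / μ (Icc (-r) 0)) atTop ≤ C₀)
    (ρ : Measure ℝ) (hρ : PotentialControl.AInfty μ ρ)
    (κ : ℝ) (hκ : 0 < κ) :
    ∃ C : ℝ≥0, 0 < C ∧ ∀ α : ℝ≥0∞, q ≤ α → α ≤ p →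
      ∀ f : ℝ → ℂ, PotentialControl.MemX μ a q p α f →
        PotentialControl.weakSup ρ κ (PotentialControl.absPotential μ k f) ≤
          C * PotentialControl.weakSup ρ κ (PotentialControl.maximalFn μ q β f) := by
  have hμ : μ univ = ∞ := top_unique ((hμ_left 0).symm.le.trans (measure_mono (subset_univ _)))
  have hβ1 : 1 ≤ β := hq.trans hqβ
  have hsum : (η⁻¹).toReal + (β⁻¹).toReal = 1 := by
    rw [← ENNReal.toReal_add, hη, ENNReal.toReal_one]
    · exact ne_top_of_le_ne_top ENNReal.one_ne_top (hη ▸ le_self_add)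
    · exact ne_top_of_le_ne_top ENNReal.one_ne_top (hη ▸ le_add_self)
  have hβpos : 0 < (β⁻¹).toReal :=
    ENNReal.toReal_pos (ENNReal.inv_ne_zero.2 hβ.ne)
      (ENNReal.inv_ne_top.2 (zero_lt_one.trans_le hβ1).ne')
  suffices h : ∃ C : ℝ≥0, 0 < C ∧ ∀ g m : ℝ → ℝ≥0∞, Measurable g →
      DominatesAverages μ (1 - (β⁻¹).toReal) g m →
        weakSup ρ κ (lpotential μ k g) ≤ C * weakSup ρ κ m by
    obtain ⟨C, hC, hmain⟩ := h
    refine ⟨C, hC, fun α _ _ f hf => ?_⟩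
    -- A measurable representative of |f| changes neither the potential at any point nor the
    -- averages.
    have hfm : AEMeasurable (fun y => ‖f y‖ₑ) μ := hf.1.enorm
    have hdom := dominatesAverages_maximalFn hq hqβ hf.1
    refine (weakSup_mono fun x => (absPotential_le_lpotential μ k f x).trans_eq
      (lpotential_congr_ae hfm.ae_eq_mk x)).trans (hmain _ _ hfm.measurable_mk ?_)
    intro I hI hb x hx
    rw [← lintegral_congr_ae (ae_restrict_of_ae hfm.ae_eq_mk)]
    exact hdom I hI hb x hx
  rw [← hsum, add_sub_cancel_right]
  rcases eq_or_ne η ∞ with hηtop | hηtop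
  · refine ⟨1, one_pos, fun g m hg hm => ?_⟩
    rw [hηtop, ENNReal.inv_top, ENNReal.toReal_zero] at hm
    simpa using weakSup_lpotential_le_of_dominatesAverages_zero hμ hρ hg hm
  · have hη0 : η ≠ 0 := by
      rintro rfl
      simp at hη
    have hθ : 0 < (η⁻¹).toReal :=
      ENNReal.toReal_pos (ENNReal.inv_ne_zero.2 hηtop) (ENNReal.inv_ne_top.2 hη0)
    refine exists_weakSup_lpotential_le (C := (⨆ y : ℝ, weakNorm μ η fun x => k (x - y)).toNNReal)
      hk_even hk_anti hk_lsc hθ (by linarith) (fun z t => ?_) hμ hρ hκ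
    rw [ENNReal.coe_toNNReal hk_right.ne]
    refine le_trans ?_ (le_iSup (fun y : ℝ => weakNorm μ η fun x => k (x - y)) z)
    rw [weakNorm, if_neg hηtop, one_div, ← ENNReal.toReal_inv]
    exact le_iSup (fun t : ℝ≥0 => (t : ℝ≥0∞) * μ {x | (t : ℝ≥0∞) < k (x - z)} ^ (η⁻¹).toReal) t
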